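/- Let $X$ and $Y$ be separable complex Banach spaces, $D\subset\mathbb C$ the open unit disc, and $\Omega\subseteq X$ a hyperbolic domain, i.e. a connected open set whose Kobayashi metric $$F_K^\Omega(p;\xi)=\inf\Big\{\tfrac{\|\xi\|}{\|\varphi'(0)\|} : \varphi:D\to\Omega \text{ holomorphic},\ \varphi(0)=p,\ \varphi'(0)=\lambda\xi \text{ for some } \lambda\in\mathbb R\Big\}$$ satisfies $F_K^\Omega(p;\xi)>0$ for all $p\in\Omega$ and $\xi\in X\setminus\{0\}$ (a disc with $\varphi'(0)=0$ contributes $+\infty$). Let $\mathcal F\subseteq \mathrm{Hol}(\Omega,Y)$ be a family of holomorphic mappings. Call $\mathcal F$ *normal* if every sequence in $\mathcal F$ has a subsequence that converges uniformly on compact subsets of $\Omega$, and *normal in the wider sense* if every sequence in $\mathcal F$ has a subsequence that either converges uniformly on compact subsets of $\Omega$ or is compactly divergent on $\Omega$. Here a sequence $(h_j)$ is compactly divergent on $S$ if for all compact $K\subseteq S$ and $L\subseteq Y$ one has $h_j(K)\cap L=\emptyset$ for all large $j$. Let $S$ be either $\Omega$ or $X$. Then $\mathcal F$ is **not** normal if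 and only if there are a sequence $(p_j)$ in $\Omega$ with $p_j\to p_0\in\Omega$, a sequence $(f_j)$ in $\mathcal F$, and reals $\rho_j>0$ with $\rho_j\to0$, such that the maps $$g_j(\xi)=f_j(p_j+\rho_j\xi)$$ (which, on any given compact set of $\xi\in X$, are defined for all large $j$) satisfy one of the following: (i) $(g_j)$ is compactly divergent on $S$; (ii) $(g_j)$ converges uniformly on compact subsets of $S$ to a non-constant holomorphic mapping $g:S\to Y$. Moreover, if $\mathcal F$ is not even normal in the wider sense, then there are such sequences satisfying (i) or (ii); and if there are such sequences satisfying (ii), then $\mathcal F$ is not normal in the wider sense. -/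

import Mathlib

open Set Filter Topology
open scoped ENNReal

/-- The infinitesimal Kobayashi metric of `Ω` at the point `p` in the direction `ξ`: the infimum of
`‖ξ‖ / ‖φ'(0)‖` over all holomorphic `φ : D → Ω` on the unit disc with `φ(0) = p` and
`φ'(0) = t ξ` for some real `t`. Values are taken in `[0, ∞]`, so that for `ξ ≠ 0` a disc with
`φ'(0) = 0` contributes `∞`. -/
noncomputable def kobayashiMetric {X : Type*} [NormedAddCommGroup X] [NormedSpace ℂ X]
    (Ω : Set X) (p ξ : X) : ℝ≥0∞ :=
  sInf {r : ℝ≥0∞ | ∃ φ : ℂ → X, DifferentiableOn ℂ φ (Metric.ball 0 1) ∧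
    MapsTo φ (Metric.ball 0 1) Ω ∧ φ 0 = p ∧ (∃ t : ℝ, deriv φ 0 = (t : ℂ) • ξ) ∧
    r = ‖ξ‖ₑ / ‖deriv φ 0‖ₑ}

/-- A domain (connected open set) on which the Kobayashi metric is non-degenerate. -/
def IsHyperbolicDomain {X : Type*} [NormedAddCommGroup X] [NormedSpace ℂ X]
    (Ω : Set X) : Prop :=
  IsOpen Ω ∧ IsConnected Ω ∧ ∀ p ∈ Ω, ∀ ξ : X, ξ ≠ 0 → kobayashiMetric Ω p ξ ≠ 0

/-- The sequence `f` converges to `g` uniformly on each compact subset of `S`. -/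
def ConvergesOnCompacts {X Y : Type*} [TopologicalSpace X] [UniformSpace Y]
    (f : ℕ → X → Y) (g : X → Y) (S : Set X) : Prop :=
  ∀ K ⊆ S, IsCompact K → TendstoUniformlyOn f g atTop K

/-- The sequence `f` is compactly divergent on `S`: for all compact `K ⊆ S` and `L ⊆ Y`, the sets
`f n (K)` and `L` are disjoint for all large `n`. -/
def CompactlyDivergent {X Y : Type*} [TopologicalSpace X] [TopologicalSpace Y]
    (f : ℕ → X → Y) (S : Set X) : Prop :=
  ∀ K ⊆ S, IsCompact K → ∀ L : Set Y, IsCompact L → ∀ᶠ n in atTop, f n '' K ∩ L = ∅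

/-- Normality as (sequential) relative compactness: every sequence in `F` has a subsequence that
converges uniformly on compact subsets of `Ω`. -/
def IsNormalFamily {X Y : Type*} [TopologicalSpace X] [UniformSpace Y]
    (Ω : Set X) (F : Set (X → Y)) : Prop :=
  ∀ f : ℕ → X → Y, (∀ n, f n ∈ F) → ∃ k : ℕ → ℕ, StrictMono k ∧
    ∃ g : X → Y, ConvergesOnCompacts (fun n => f (k n)) g Ω

/-- Normality in the wider sense: every sequence in `F` has a subsequence that converges uniformly
on compact subsets of `Ω` or one that is compactly divergent on `Ω`. -/
def IsNormalFamilyWide {X Y : Type*} [TopologicalSpace X] [UniformSpace Y]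
    (Ω : Set X) (F : Set (X → Y)) : Prop :=
  ∀ f : ℕ → X → Y, (∀ n, f n ∈ F) → ∃ k : ℕ → ℕ, StrictMono k ∧
    ((∃ g : X → Y, ConvergesOnCompacts (fun n => f (k n)) g Ω) ∨
      CompactlyDivergent (fun n => f (k n)) Ω)

/-- `g` is a sequence of rescalings `g j ξ = f j (p j + ρ j ξ)` of members `f j` of `F`, with
points `p j → p₀` in `Ω` and scales `ρ j > 0` tending to `0`. For a given compact set of `ξ`, the
points `p j + ρ j ξ` lie in `Ω` as soon as `j` is large; nothing is claimed about other `j`. -/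
def IsRescaling {X Y : Type*} [NormedAddCommGroup X] [NormedSpace ℂ X]
    (Ω : Set X) (F : Set (X → Y)) (g : ℕ → X → Y) : Prop :=
  ∃ (p : ℕ → X) (p₀ : X) (f : ℕ → X → Y) (ρ : ℕ → ℝ),
    (∀ j, p j ∈ Ω) ∧ p₀ ∈ Ω ∧ Tendsto p atTop (𝓝 p₀) ∧ (∀ j, f j ∈ F) ∧
    (∀ j, 0 < ρ j) ∧ Tendsto ρ atTop (𝓝 0) ∧
    ∀ j ξ, g j ξ = f j (p j + (ρ j : ℂ) • ξ)

/-- The sequence `g` converges, uniformly on compact subsets of `S`, to a holomorphic mapping on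
`S` that is not constant. -/
def ConvergesToNonconstant {X Y : Type*} [NormedAddCommGroup X] [NormedSpace ℂ X]
    [NormedAddCommGroup Y] [NormedSpace ℂ Y] (g : ℕ → X → Y) (S : Set X) : Prop :=
  ∃ h : X → Y, DifferentiableOn ℂ h S ∧ (∃ ξ ∈ S, ∃ η ∈ S, h ξ ≠ h η) ∧
    ConvergesOnCompacts g h S

/-! ### Compact convergence, compact divergence and Arzelà–Ascoli in metric spaces. -/

section Topological

variable {X Y : Type*} [MetricSpace X] [MetricSpace Y]

/-! Everything turns on whether values `f j (p j)` with `p j → p₀` in `Ω` always subconverge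
(`HasSubconvergentValues`). If they do, the family is locally bounded, hence equicontinuous by the
Schwarz lemma, and Arzelà–Ascoli gives normality. If they do not, continuity allows `ρ j` so small
that `g j` is almost constant on large balls, so it diverges together with `f j (p j)`
(`exists_isRescaling_compactlyDivergent`). Thus non-normality always yields alternative (i), even on
all of `X`.

Conversely `p j + ρ j ξ → p₀` for every `ξ`, so a convergent subsequence of `f j` forces `g j ξ` to
a limit independent of `ξ`, which excludes both (i) and (ii). -/

/-- A sequence converging to a point of an open set eventually lies, together with its limit, in
a compact subset of that open set. -/
theorem exists_isCompact_subset_of_tendsto {Ω : Set X} (hΩ : IsOpen Ω) {x : ℕ → X} {x₀ : X}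
    (hx₀ : x₀ ∈ Ω) (hx : Tendsto x atTop (𝓝 x₀)) :
    ∃ K ⊆ Ω, IsCompact K ∧ x₀ ∈ K ∧ ∀ᶠ n in atTop, x n ∈ K := by
  obtain ⟨N, hN⟩ := eventually_atTop.1 (hx.eventually (hΩ.mem_nhds hx₀))
  refine ⟨insert x₀ (range fun n => x (n + N)), ?_,
    ((tendsto_add_atTop_iff_nat N).2 hx).isCompact_insert_range, mem_insert _ _, ?_⟩
  · rintro _ (rfl | ⟨n, rfl⟩)
    · exact hx₀
    · exact hN _ (Nat.le_add_left _ _)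
  · filter_upwards [eventually_ge_atTop N] with n hn
    exact Or.inr ⟨n - N, by simp [Nat.sub_add_cancel hn]⟩

/-- Uniform convergence on compact sets implies continuous convergence. -/
theorem ConvergesOnCompacts.tendsto_apply {Ω : Set X} (hΩ : IsOpen Ω) {f : ℕ → X → Y}
    {g : X → Y} (hf : ∀ n, ContinuousOn (f n) Ω) (h : ConvergesOnCompacts f g Ω)
    {x : ℕ → X} {x₀ : X} (hx₀ : x₀ ∈ Ω) (hx : Tendsto x atTop (𝓝 x₀)) :
    Tendsto (fun n => f n (x n)) atTop (𝓝 (g x₀)) := by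
  obtain ⟨K, hKΩ, hK, hx₀K, hxK⟩ := exists_isCompact_subset_of_tendsto hΩ hx₀ hx
  have hu := h K hKΩ hK
  have hg : ContinuousOn g K :=
    hu.continuousOn (Eventually.of_forall fun n => (hf n).mono hKΩ).frequently
  exact tendsto_comp_of_locally_uniform_limit_within (hg x₀ hx₀K)
    (tendsto_nhdsWithin_iff.2 ⟨hx, hxK⟩) fun u hu' => ⟨K, self_mem_nhdsWithin, hu u hu'⟩

theorem ConvergesOnCompacts.tendsto_at {g : ℕ → X → Y} {h : X → Y} {S : Set X}
    (hg : ConvergesOnCompacts g h S) {ξ : X} (hξ : ξ ∈ S) :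
    Tendsto (fun n => g n ξ) atTop (𝓝 (h ξ)) :=
  (hg {ξ} (singleton_subset_iff.2 hξ) isCompact_singleton).tendsto_at (mem_singleton ξ)

theorem CompactlyDivergent.comp_strictMono {S : Set X} {f : ℕ → X → Y}
    (h : CompactlyDivergent f S) {φ : ℕ → ℕ} (hφ : StrictMono φ) :
    CompactlyDivergent (fun n => f (φ n)) S :=
  fun K hKS hK L hL => hφ.tendsto_atTop.eventually (h K hKS hK L hL)

/-- A convergent sequence together with its limit is a compact `L` that the images of `K` would keep
meeting. -/
theorem CompactlyDivergent.not_tendsto_apply_of_mem_compact {S K : Set X} {f : ℕ → X → Y}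
    (h : CompactlyDivergent f S) (hKS : K ⊆ S) (hK : IsCompact K) {x : ℕ → X}
    (hx : ∀ᶠ n in atTop, x n ∈ K) (y : Y) :
    ¬ Tendsto (fun n => f n (x n)) atTop (𝓝 y) := by
  intro hy
  obtain ⟨n, hn, hnK⟩ := ((h K hKS hK _ hy.isCompact_insert_range).and hx).exists
  exact notMem_empty (f n (x n)) (hn ▸ ⟨mem_image_of_mem _ hnK, Or.inr ⟨n, rfl⟩⟩)

theorem isCompact_closure_of_forall_tendsto_subseq {A : Set Y}
    (h : ∀ a : ℕ → Y, (∀ n, a n ∈ A) →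
      ∃ k : ℕ → ℕ, StrictMono k ∧ ∃ y, Tendsto (a ∘ k) atTop (𝓝 y)) :
    IsCompact (closure A) := by
  refine IsSeqCompact.isCompact fun x hx => ?_
  choose a haA hxa using fun n : ℕ =>
    Metric.mem_closure_iff.1 (hx n) (1 / ((n : ℝ) + 1)) Nat.one_div_pos_of_nat
  obtain ⟨k, hk, y, hy⟩ := h a haA
  have hd : Tendsto (fun n => dist (a n) (x n)) atTop (𝓝 0) :=
    squeeze_zero (fun _ => dist_nonneg) (fun n => (dist_comm (a n) (x n)).trans_le (hxa n).le)
      tendsto_one_div_add_atTop_nhds_zero_nat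
  exact ⟨y, mem_closure_of_tendsto hy (Eventually.of_forall fun n => haA _), k, hk,
    (tendsto_iff_of_dist (hd.comp hk.tendsto_atTop)).1 hy⟩

/-- The Arzelà–Ascoli theorem for sequences on an open subset of a separable metric space. -/
theorem exists_convergesOnCompacts_subseq [TopologicalSpace.SeparableSpace X] [CompleteSpace Y]
    {Ω : Set X} {f : ℕ → X → Y}
    (hequi : ∀ x ∈ Ω, ∀ ε > 0, ∃ U ∈ 𝓝 x, ∀ n, ∀ y ∈ U, dist (f n y) (f n x) < ε)
    (hcomp : ∀ x ∈ Ω, IsCompact (closure (range fun n => f n x))) :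
    ∃ k : ℕ → ℕ, StrictMono k ∧ ∃ g : X → Y, ConvergesOnCompacts (fun n => f (k n)) g Ω := by
  have : SecondCountableTopology X := UniformSpace.secondCountable_of_separable X
  obtain ⟨D, hDc, hD⟩ := TopologicalSpace.exists_countable_dense Ω
  have : Countable D := hDc.to_subtype
  -- Sequential compactness of the countable product replaces the diagonal argument.
  obtain ⟨a, -, k, hk, ha⟩ :=
    (isCompact_univ_pi fun d : D => hcomp d.1 d.1.2).tendsto_subseq
      (x := fun n d => f n d.1) fun n d _ => subset_closure (mem_range_self n)
  rw [tendsto_pi_nhds] at ha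
  have hlim : ∀ x : X, ∃ y, x ∈ Ω → Tendsto (fun n => f (k n) x) atTop (𝓝 y) := by
    intro x
    by_cases hx : x ∈ Ω
    swap
    -- Arbitrary value off `Ω`.
    · exact ⟨f 0 x, fun h => absurd h hx⟩
    have hc : CauchySeq fun n => f (k n) x := by
      rw [Metric.cauchySeq_iff]
      intro ε hε
      obtain ⟨U, hU, hUf⟩ := hequi x hx (ε / 3) (by positivity)
      obtain ⟨d, hdU, hdD⟩ := mem_closure_iff_nhds.1 (hD ⟨x, hx⟩) (Subtype.val ⁻¹' U)
        (continuous_subtype_val.continuousAt hU)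
      obtain ⟨N, hN⟩ := Metric.cauchySeq_iff.1 (ha ⟨d, hdD⟩).cauchySeq (ε / 3) (by positivity)
      refine ⟨N, fun m hm n hn => ?_⟩
      have h₁ := hUf (k m) d hdU
      have h₂ := hUf (k n) d hdU
      have h₃ : dist (f (k m) d) (f (k n) d) < ε / 3 := hN m hm n hn
      have h₄ := dist_triangle4 (f (k m) x) (f (k m) d) (f (k n) d) (f (k n) x)
      rw [dist_comm (f (k m) x) (f (k m) d)] at h₄
      linarith
    obtain ⟨y, hy⟩ := cauchySeq_tendsto_of_complete hc
    exact ⟨y, fun _ => hy⟩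
  choose g hg using hlim
  refine ⟨k, hk, g, fun K hKΩ hK => ?_⟩
  rw [← tendstoLocallyUniformlyOn_iff_tendstoUniformlyOn_of_compact hK,
    Metric.tendstoLocallyUniformlyOn_iff]
  intro ε hε x hx
  obtain ⟨U, hU, hUf⟩ := hequi x (hKΩ hx) (ε / 4) (by positivity)
  refine ⟨U ∩ K, inter_mem (mem_nhdsWithin_of_mem_nhds hU) self_mem_nhdsWithin, ?_⟩
  filter_upwards [Metric.tendsto_nhds.1 (hg x (hKΩ hx)) (ε / 4) (by positivity)]
    with n hn y hy
  have h₁ := hUf (k n) y hy.1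
  have h₂ : dist (g y) (g x) ≤ ε / 4 :=
    le_of_tendsto ((hg y (hKΩ hy.2)).dist (hg x (hKΩ hx)))
      (Eventually.of_forall fun m => (hUf (k m) y hy.1).le)
  have h₃ := dist_triangle4 (g y) (g x) (f (k n) x) (f (k n) y)
  rw [dist_comm (g x), dist_comm (f (k n) x) (f (k n) y)] at h₃
  linarith

theorem IsNormalFamily.isNormalFamilyWide {Ω : Set X} {F : Set (X → Y)}
    (h : IsNormalFamily Ω F) :
    IsNormalFamilyWide Ω F :=
  fun f hf => let ⟨k, hk, hg⟩ := h f hf; ⟨k, hk, Or.inl hg⟩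

end Topological

/-! ### Rescalings and normality of families on an open set. -/

/-- The values of `F` along convergent sequences in `Ω` are relatively compact. -/
def HasSubconvergentValues {X Y : Type*} [TopologicalSpace X] [TopologicalSpace Y]
    (Ω : Set X) (F : Set (X → Y)) : Prop :=
  ∀ (p : ℕ → X) (p₀ : X) (f : ℕ → X → Y), (∀ j, p j ∈ Ω) → p₀ ∈ Ω → Tendsto p atTop (𝓝 p₀) →
    (∀ j, f j ∈ F) → ∃ k : ℕ → ℕ, StrictMono k ∧ ∃ y, Tendsto (fun n => f (k n) (p (k n))) atTop (𝓝 y)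

section Holomorphic

variable {X Y : Type*} [NormedAddCommGroup X] [NormedAddCommGroup Y] {Ω : Set X} {F : Set (X → Y)}

/-- Otherwise balls shrinking to `p₀` contain points `p n` with `‖f n (p n)‖ > n`, and no
subsequence of these values converges. -/
theorem HasSubconvergentValues.exists_bound_on_ball (h : HasSubconvergentValues Ω F)
    (hΩ : IsOpen Ω) {p₀ : X} (hp₀ : p₀ ∈ Ω) :
    ∃ r > 0, Metric.ball p₀ r ⊆ Ω ∧ ∃ M : ℝ, ∀ f ∈ F, ∀ x ∈ Metric.ball p₀ r, ‖f x‖ ≤ M := by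
  obtain ⟨R, hR, hRΩ⟩ := Metric.isOpen_iff.1 hΩ p₀ hp₀
  by_contra! hcon
  have hr : ∀ n : ℕ, 0 < min R (1 / ((n : ℝ) + 1)) := fun n =>
    lt_min hR Nat.one_div_pos_of_nat
  choose f hfF p hp hfp using fun n : ℕ => hcon (min R (1 / ((n : ℝ) + 1))) (hr n)
    ((Metric.ball_subset_ball (min_le_left _ _)).trans hRΩ) n
  have hpt : Tendsto p atTop (𝓝 p₀) := by
    rw [tendsto_iff_dist_tendsto_zero]
    exact squeeze_zero (fun _ => dist_nonneg)
      (fun n => (lt_of_lt_of_le (hp n) (min_le_right _ _)).le)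
      tendsto_one_div_add_atTop_nhds_zero_nat
  obtain ⟨k, hk, y, hy⟩ := h p p₀ f
    (fun n => hRΩ (Metric.ball_subset_ball (min_le_left _ _) (hp n))) hp₀ hpt hfF
  exact not_tendsto_nhds_of_tendsto_atTop
    (tendsto_atTop_mono (fun n => (hfp (k n)).le)
      (tendsto_natCast_atTop_atTop.comp hk.tendsto_atTop)) _ hy.norm

variable [NormedSpace ℂ X]

/-- Without relative compactness of the values, a sufficiently strong zoom produces a compactly
divergent rescaling. -/
theorem exists_isRescaling_compactlyDivergent (h : ¬ HasSubconvergentValues Ω F) (hΩ : IsOpen Ω)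
    (hF : ∀ f ∈ F, ContinuousOn f Ω) :
    ∃ g : ℕ → X → Y, IsRescaling Ω F g ∧ CompactlyDivergent g univ := by
  unfold HasSubconvergentValues at h
  push Not at h
  obtain ⟨p, p₀, f, hp, hp₀, hpt, hf, hdiv⟩ := h
  have hscale : ∀ j : ℕ, ∃ ρ : ℝ, 0 < ρ ∧ ρ ≤ 1 / ((j : ℝ) + 1) ∧ ∀ ξ : X, ‖ξ‖ ≤ j →
      dist (f j (p j + (ρ : ℂ) • ξ)) (f j (p j)) ≤ 1 / ((j : ℝ) + 1) := by
    intro j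
    obtain ⟨δ, hδ, hδf⟩ := Metric.continuousAt_iff.1
      ((hF _ (hf j)).continuousAt (hΩ.mem_nhds (hp j))) (1 / ((j : ℝ) + 1)) Nat.one_div_pos_of_nat
    have hj : (0 : ℝ) < (j : ℝ) + 1 := by positivity
    -- The first term sends `ρ` to zero; the second keeps `ρ ‖ξ‖ < δ` for all `‖ξ‖ ≤ j`.
    have hρ : 0 < min (1 / ((j : ℝ) + 1)) (δ / ((j : ℝ) + 1)) := by positivity
    refine ⟨_, hρ, min_le_left _ _, fun ξ hξ => (hδf ?_).le⟩
    rw [dist_self_add_left, norm_smul, Complex.norm_real, Real.norm_of_nonneg hρ.le]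
    calc _ ≤ δ / ((j : ℝ) + 1) * j := by gcongr; exact min_le_right _ _
      _ < δ := by rw [div_mul_eq_mul_div, div_lt_iff₀ hj]; nlinarith
  choose ρ hρ hρle hρf using hscale
  refine ⟨fun j ξ => f j (p j + (ρ j : ℂ) • ξ), ⟨p, p₀, f, ρ, hp, hp₀, hpt, hf, hρ,
    squeeze_zero (fun j => (hρ j).le) hρle tendsto_one_div_add_atTop_nhds_zero_nat,
    fun _ _ => rfl⟩, fun K _ hK L hL => ?_⟩
  by_contra hcon
  obtain ⟨φ, hφ, hφK⟩ := extraction_of_frequently_atTop (not_eventually.1 hcon)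
  have hmeet : ∀ n, ∃ ξ ∈ K, f (φ n) (p (φ n) + (ρ (φ n) : ℂ) • ξ) ∈ L := by
    intro n
    obtain ⟨_, ⟨ξ, hξ, rfl⟩, hL⟩ := nonempty_iff_ne_empty.2 (hφK n)
    exact ⟨ξ, hξ, hL⟩
  choose ξ hξK hξL using hmeet
  obtain ⟨y, -, ψ, hψ, hy⟩ := hL.tendsto_subseq hξL
  obtain ⟨R, hR⟩ := hK.isBounded.exists_norm_le
  have hφψ := hφ.comp hψ
  -- Once `j` exceeds the bound `R` of `K`, the values in `L` are within `1 / (j + 1)` of `f j (p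
  -- j)`, which would then subconverge too.
  refine hdiv (φ ∘ ψ) hφψ y ((tendsto_iff_of_dist ?_).1 hy)
  refine squeeze_zero' (Eventually.of_forall fun _ => dist_nonneg) ?_
    (tendsto_one_div_add_atTop_nhds_zero_nat.comp hφψ.tendsto_atTop)
  filter_upwards [(tendsto_natCast_atTop_atTop.comp hφψ.tendsto_atTop).eventually_ge_atTop R]
    with n hn
  exact hρf _ _ ((hR _ (hξK _)).trans hn)

theorem tendsto_add_smul_nhds {p : ℕ → X} {p₀ : X} {ρ : ℕ → ℝ} (hp : Tendsto p atTop (𝓝 p₀))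
    (hρ : Tendsto ρ atTop (𝓝 0)) (ξ : X) :
    Tendsto (fun j => p j + (ρ j : ℂ) • ξ) atTop (𝓝 p₀) := by
  have hρ' : Tendsto (fun j => (ρ j : ℂ)) atTop (𝓝 0) := by
    simpa [Function.comp_def] using (Complex.continuous_ofReal.tendsto 0).comp hρ
  simpa using hp.add (hρ'.smul_const ξ)

/-- Rescalings with a uniformly convergent base sequence converge pointwise to a constant. -/
theorem tendsto_rescaling_of_convergesOnCompacts (hΩ : IsOpen Ω) {f : ℕ → X → Y} {f₀ : X → Y}
    {k : ℕ → ℕ} (hk : StrictMono k) (hf : ∀ n, ContinuousOn (f n) Ω)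
    (h : ConvergesOnCompacts (fun n => f (k n)) f₀ Ω) {p : ℕ → X} {p₀ : X} (hp₀ : p₀ ∈ Ω)
    (hp : Tendsto p atTop (𝓝 p₀)) {ρ : ℕ → ℝ} (hρ : Tendsto ρ atTop (𝓝 0)) (ξ : X) :
    Tendsto (fun n => f (k n) (p (k n) + (ρ (k n) : ℂ) • ξ)) atTop (𝓝 (f₀ p₀)) :=
  h.tendsto_apply hΩ (fun n => hf (k n)) hp₀
    ((tendsto_add_smul_nhds hp hρ ξ).comp hk.tendsto_atTop)

theorem not_isNormalFamily_of_rescaling_compactlyDivergent (hΩ : IsOpen Ω)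
    (hF : ∀ f ∈ F, ContinuousOn f Ω) {S : Set X} (hS : S.Nonempty) {g : ℕ → X → Y}
    (hg : IsRescaling Ω F g) (hgS : CompactlyDivergent g S) : ¬ IsNormalFamily Ω F := by
  intro hN
  obtain ⟨p, p₀, f, ρ, -, hp₀, hpt, hf, -, hρ, hgf⟩ := hg
  obtain ⟨ξ, hξ⟩ := hS
  obtain ⟨k, hk, f₀, hf₀⟩ := hN f hf
  refine (hgS.comp_strictMono hk).not_tendsto_apply_of_mem_compact (singleton_subset_iff.2 hξ)
    isCompact_singleton (x := fun _ => ξ) (Eventually.of_forall fun _ => mem_singleton ξ) (f₀ p₀) ?_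
  simpa only [hgf] using tendsto_rescaling_of_convergesOnCompacts hΩ hk (fun n => hF _ (hf n)) hf₀
    hp₀ hpt hρ ξ

variable [NormedSpace ℂ Y]

theorem HasSubconvergentValues.isNormalFamily [TopologicalSpace.SeparableSpace X] [CompleteSpace Y]
    (h : HasSubconvergentValues Ω F) (hΩ : IsOpen Ω) (hF : ∀ f ∈ F, DifferentiableOn ℂ f Ω) :
    IsNormalFamily Ω F := by
  intro f hf
  refine exists_convergesOnCompacts_subseq (fun x hx ε hε => ?_) fun x hx => ?_
  · obtain ⟨r, hr, hrΩ, M, hM⟩ := h.exists_bound_on_ball hΩ hx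
    have hM₀ : 0 ≤ M := (norm_nonneg _).trans (hM _ (hf 0) x (Metric.mem_ball_self hr))
    -- `(2 * M + 1) / r` is the Schwarz–Lipschitz constant at the centre; the `+ 1` keeps it
    -- positive when `M = 0`.
    refine ⟨Metric.ball x (min r (ε / ((2 * M + 1) / r))),
      Metric.ball_mem_nhds _ (by positivity), fun n y hy => ?_⟩
    have hyr : y ∈ Metric.ball x r := Metric.ball_subset_ball (min_le_left _ _) hy
    have hmaps : MapsTo (f n) (Metric.ball x r) (Metric.closedBall (f n x) (2 * M + 1)) := by
      intro z hz
      rw [Metric.mem_closedBall, dist_eq_norm]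
      linarith [norm_sub_le (f n z) (f n x), hM _ (hf n) z hz,
        hM _ (hf n) x (Metric.mem_ball_self hr)]
    have hyε : dist y x < ε / ((2 * M + 1) / r) :=
      lt_of_lt_of_le (Metric.mem_ball.1 hy) (min_le_right _ _)
    rw [lt_div_iff₀' (by positivity)] at hyε
    exact (Complex.dist_le_div_mul_dist_of_mapsTo_ball ((hF _ (hf n)).mono hrΩ) hmaps hyr).trans_lt
      hyε
  · refine isCompact_closure_of_forall_tendsto_subseq fun a ha => ?_
    choose m hm using ha
    obtain ⟨k, hk, y, hy⟩ := h (fun _ => x) x (fun j => f (m j)) (fun _ => hx) hx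
      tendsto_const_nhds fun j => hf _
    exact ⟨k, hk, y, by simpa only [hm, Function.comp_def] using hy⟩

/-- A convergent subsequence of the `f j` would make the limit of the rescalings constant. A
compactly divergent one is impossible because the points `p j + ρ j ξ` eventually stay in a compact
part of `Ω` while their values converge. -/
theorem not_isNormalFamilyWide_of_rescaling (hΩ : IsOpen Ω) (hF : ∀ f ∈ F, ContinuousOn f Ω)
    {S : Set X} {g : ℕ → X → Y} (hg : IsRescaling Ω F g) (hgS : ConvergesToNonconstant g S) :
    ¬ IsNormalFamilyWide Ω F := by
  intro hN
  obtain ⟨p, p₀, f, ρ, -, hp₀, hpt, hf, -, hρ, hgf⟩ := hg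
  obtain ⟨h, -, ⟨ξ, hξ, η, hη, hne⟩, hgh⟩ := hgS
  have hlim : ∀ k : ℕ → ℕ, StrictMono k → ∀ ζ ∈ S,
      Tendsto (fun n => f (k n) (p (k n) + (ρ (k n) : ℂ) • ζ)) atTop (𝓝 (h ζ)) := by
    intro k hk ζ hζ
    simpa only [hgf, Function.comp_def] using (hgh.tendsto_at hζ).comp hk.tendsto_atTop
  obtain ⟨k, hk, ⟨f₀, hf₀⟩ | hdiv⟩ := hN f hf
  · have hconst := tendsto_rescaling_of_convergesOnCompacts hΩ hk (fun n => hF _ (hf n)) hf₀ hp₀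
      hpt hρ
    exact hne ((tendsto_nhds_unique (hlim k hk ξ hξ) (hconst ξ)).trans
      (tendsto_nhds_unique (hlim k hk η hη) (hconst η)).symm)
  · obtain ⟨K, hKΩ, hK, -, hxK⟩ := exists_isCompact_subset_of_tendsto hΩ hp₀
      ((tendsto_add_smul_nhds hpt hρ ξ).comp hk.tendsto_atTop)
    exact hdiv.not_tendsto_apply_of_mem_compact hKΩ hK hxK _ (hlim k hk ξ hξ)

end Holomorphic

theorem proposition2p1 {X Y : Type*}
    [NormedAddCommGroup X] [NormedSpace ℂ X] [CompleteSpace X] [TopologicalSpace.SeparableSpace X]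
    [NormedAddCommGroup Y] [NormedSpace ℂ Y] [CompleteSpace Y] [TopologicalSpace.SeparableSpace Y]
    (Ω : Set X) (hΩ : IsHyperbolicDomain Ω)
    (F : Set (X → Y)) (hF : ∀ f ∈ F, DifferentiableOn ℂ f Ω) :
    -- the rescaled sequence is tested on the compact subsets of `S = Ω`, or of `S = X`
    (∀ S : Set X, S = Ω ∨ S = Set.univ →
      (¬ IsNormalFamily Ω F ↔
        ∃ g : ℕ → X → Y, IsRescaling Ω F g ∧
          (CompactlyDivergent g S ∨ ConvergesToNonconstant g S)) ∧
      -- normality in the wider sense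
      (¬ IsNormalFamilyWide Ω F →
        ∃ g : ℕ → X → Y, IsRescaling Ω F g ∧
          (CompactlyDivergent g S ∨ ConvergesToNonconstant g S)) ∧
      ((∃ g : ℕ → X → Y, IsRescaling Ω F g ∧ ConvergesToNonconstant g S) →
        ¬ IsNormalFamilyWide Ω F)) := by
  have hopen := hΩ.1
  have hcont : ∀ f ∈ F, ContinuousOn f Ω := fun f hf => (hF f hf).continuousOn
  have hzoom : ¬ IsNormalFamily Ω F → ∀ S : Set X, ∃ g : ℕ → X → Y, IsRescaling Ω F g ∧
      (CompactlyDivergent g S ∨ ConvergesToNonconstant g S) := fun hN S =>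
    let ⟨g, hg, hdiv⟩ := exists_isRescaling_compactlyDivergent
      (fun h => hN (h.isNormalFamily hopen hF)) hopen hcont
    ⟨g, hg, Or.inl fun K _ hK => hdiv K (subset_univ K) hK⟩
  intro S hS
  have hne : S.Nonempty := by
    rcases hS with rfl | rfl
    · exact hΩ.2.1.nonempty
    · exact hΩ.2.1.nonempty.mono (subset_univ _)
  refine ⟨⟨fun hN => hzoom hN S, ?_⟩, fun hN => hzoom (fun h => hN h.isNormalFamilyWide) S, ?_⟩
  · rintro ⟨g, hg, hdiv | hconv⟩
    · exact not_isNormalFamily_of_rescaling_compactlyDivergent hopen hcont hne hg hdiv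
    · exact fun hN => not_isNormalFamilyWide_of_rescaling hopen hcont hg hconv
        hN.isNormalFamilyWide
  · rintro ⟨g, hg, hconv⟩
    exact not_isNormalFamilyWide_of_rescaling hopen hcont hg hconv
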